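/- Let $F_0=0$, $F_1=1$, $F_m=F_{m-1}+F_{m-2}$ for $m\ge 2$ be the Fibonacci numbers. Define finite binary words by $R_0=0$, $R_1=00$ and, for $m\ge 2$, $R_m=R_{m-1}R_{m-2}$ if $m\equiv 0 \pmod 3$ and $R_m=R_{m-1}\overline{R_{m-2}}$ otherwise, where $\overline{w}$ is the word obtained from $w$ by exchanging the letters $0$ and $1$. Each $R_m$ is a prefix of $R_{m+1}$; let $\mathbf{r}=r_0r_1r_2\cdots=001001101101100100\cdots$ (the Rote-Fibonacci word) be the limit of the $R_m$, that is, the infinite word that has every $R_m$ as a prefix. Theorem. Let $k\ge 1$, let $n=2F_{3k+2}$, and let $z=\mathbf{r}[0..n-1]=r_0r_1\cdots r_{n-1}$. Then the infinite periodic word $z^\omega=zzz\cdots$ contains no occurrence of the pattern $x\,x\,x^R$: there is no nonempty finite word $x$ such that $x\,x\,x^R$ is a factor of $z^\omega$, where $x^R$ denotes the reversal of $x$. -/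

import Mathlib

/-! Binary words are lists over `Bool`, with `false` for the letter `0` and `true` for the
letter `1`. Infinite words over `α` are functions `ℕ → α`, indexed from `0`. -/

/-- The finite Rote-Fibonacci words `R 0 = 0`, `R 1 = 00` and, for `n ≥ 2`,
`R n = R (n-1) R (n-2)` if `n ≡ 0 (mod 3)`, while otherwise `R n` is `R (n-1)` followed by the
complement of `R (n-2)`. -/
def finiteRoteFibonacci : ℕ → List Bool
  | 0 => [false]
  | 1 => [false, false]
  | n + 2 =>
    if (n + 2) % 3 = 0 then finiteRoteFibonacci (n + 1) ++ finiteRoteFibonacci n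
    else finiteRoteFibonacci (n + 1) ++ (finiteRoteFibonacci n).map Bool.not

theorem length_finiteRoteFibonacci (n : ℕ) :
    (finiteRoteFibonacci n).length = Nat.fib (n + 2) := by
  induction n using Nat.strong_induction_on with
  | _ n ih =>
    match n, ih with
    | 0, _ => rfl
    | 1, _ => rfl
    | n + 2, ih =>
      have h1 := ih (n + 1) (by omega)
      have h0 := ih n (by omega)
      have h2 : Nat.fib (n + 2 + 2) = Nat.fib (n + 2) + Nat.fib (n + 1 + 2) :=
        Nat.fib_add_two
      rw [finiteRoteFibonacci]
      split_ifs <;> simp [h1, h0] <;> omega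

theorem lt_length_finiteRoteFibonacci (n : ℕ) : n < (finiteRoteFibonacci n).length := by
  rw [length_finiteRoteFibonacci]
  have h := Nat.le_fib_add_one (n + 2)
  induction n with
  | zero => decide
  | succ n ih =>
    have h1 := ih (Nat.le_fib_add_one _)
    have h2 : Nat.fib (n + 1 + 2) = Nat.fib (n + 1) + Nat.fib (n + 2) := Nat.fib_add_two
    have h3 : 0 < Nat.fib (n + 1) := Nat.fib_pos.2 (by omega)
    omega

/-- The words `R n` form a chain of prefixes, so that they have a limit. -/
theorem finiteRoteFibonacci_prefix {m n : ℕ} (h : m ≤ n) :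
    finiteRoteFibonacci m <+: finiteRoteFibonacci n := by
  induction n, h using Nat.le_induction with
  | base => exact List.prefix_rfl
  | succ n _ ih =>
    refine ih.trans ?_
    match n with
    | 0 => exact ⟨[false], rfl⟩
    | n + 1 =>
      rw [finiteRoteFibonacci]
      split_ifs <;> exact List.prefix_append _ _

/-- The Rote-Fibonacci word `r = 001001101101100100110110110010…`, the limit of the words `R n`:
its `i`-th letter is that of `R i`, which is long enough. -/
def roteFibonacci (i : ℕ) : Bool :=
  (finiteRoteFibonacci i)[i]'(lt_length_finiteRoteFibonacci i)

/-- Every `R n` is a prefix of the Rote-Fibonacci word. -/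
theorem getElem_finiteRoteFibonacci {n i : ℕ} (h : i < (finiteRoteFibonacci n).length) :
    (finiteRoteFibonacci n)[i] = roteFibonacci i := by
  unfold roteFibonacci
  rcases le_total i n with hin | hin
  · exact ((finiteRoteFibonacci_prefix hin).getElem (lt_length_finiteRoteFibonacci i)).symm
  · exact (finiteRoteFibonacci_prefix hin).getElem h

/-- The factor `u[i..i+n-1]` of length `n` of the infinite word `u` that starts at position `i`. -/
def wordFactor {α : Type*} (u : ℕ → α) (i n : ℕ) : List α :=
  (List.range n).map fun j => u (i + j)

/-- The infinite periodic word `z^ω = zzz⋯`, for a nonempty finite word `z`. -/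
def omegaPower {α : Type*} (z : List α) (hz : z ≠ []) (i : ℕ) : α :=
  z[i % z.length]'(Nat.mod_lt _ (List.length_pos_iff.2 hz))

/-- The finite word `w` occurs in the infinite word `u`. -/
def OccursIn {α : Type*} (w : List α) (u : ℕ → α) : Prop :=
  ∃ i, wordFactor u i w.length = w

/-- The infinite word `u` contains an occurrence of the pattern `x x x^R`, that is, a factor
`x x x^R` with `x` a nonempty finite word. -/
def ContainsXXXR {α : Type*} (u : ℕ → α) : Prop :=
  ∃ x : List α, x ≠ [] ∧ OccursIn (x ++ x ++ x.reverse) u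

/-! Put `n = 3k+1`, `M = F n`, `N = F (n+1)`; both are odd. The periodic word codes a rotation: its
letter `i` is `1` exactly when `⌊(iM + c)/N⌋` is even (`omegaPower_eq_rotation`).

In an occurrence of `x x x^R` with `|x| = p`, the square says that `p` consecutive points keep their
letter under a shift `q ≡ pM` modulo `2N`. The palindrome `x x^R`, composed with the
letter-reversing reflection `v ↦ -1 - v`, says that `2p` consecutive points keep theirs under a
shift `s`, which is odd. Long runs of points meet short arcs (`exists_rotation_mem_arc`), so both
shifts are small. This forces `p = F (m+1)` with `F m` even (`eq_fib_of_small`). Two points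
symmetric about the centre of the palindrome then give `|s| < F (n-m-1)`, and at a third point `q`
changes the letter (`no_XXXR_rotation`). -/

/-! ### Fibonacci identities. -/

/-- Dynamically, `F (j+1)` steps of the rotation by `F (j+e)` modulo `F (j+e+1)` displace a point by
`± F e`. -/
theorem fib_succ_mul_sub (j e : ℕ) :
    (Nat.fib (j + 1) : ℤ) * Nat.fib (j + e) - Nat.fib j * Nat.fib (j + e + 1)
      = (-1) ^ j * Nat.fib e := by
  induction j with
  | zero => simp
  | succ j ih =>
    have h1 : Nat.fib (j + 1 + 1) = Nat.fib j + Nat.fib (j + 1) := Nat.fib_add_two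
    have h2 : Nat.fib (j + 1 + e + 1) = Nat.fib (j + e) + Nat.fib (j + e + 1) := by
      rw [show j + 1 + e + 1 = j + e + 2 by ring]; exact Nat.fib_add_two
    rw [h1, h2, show j + 1 + e = j + e + 1 by ring, pow_succ]
    push_cast
    linear_combination -ih

theorem fib_mod_two (n : ℕ) : Nat.fib n % 2 = if n % 3 = 0 then 0 else 1 := by
  induction n using Nat.strong_induction_on with
  | _ n ih =>
    match n, ih with
    | 0, _ => rfl
    | 1, _ => rfl
    | n + 2, ih =>
      have h1 := ih (n + 1) (by omega)
      have h0 := ih n (by omega)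
      have h2 : Nat.fib (n + 2) = Nat.fib n + Nat.fib (n + 1) := Nat.fib_add_two
      split_ifs at * <;> omega

/-- Consecutive pairs of Fibonacci numbers form bases of `ℤ²`. -/
theorem exists_fib_combination (μ : ℕ) (p t : ℤ) :
    ∃ a b : ℤ, p = a * Nat.fib (μ + 2) + b * Nat.fib (μ + 1) ∧
      t = a * Nat.fib (μ + 1) + b * Nat.fib μ := by
  induction μ with
  | zero => exact ⟨t, p - t, by simp, by simp⟩
  | succ μ ih =>
    obtain ⟨a, b, h1, h2⟩ := ih
    have h3 : Nat.fib (μ + 1 + 2) = Nat.fib (μ + 1) + Nat.fib (μ + 2) := Nat.fib_add_two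
    have h4 : Nat.fib (μ + 2) = Nat.fib μ + Nat.fib (μ + 1) := Nat.fib_add_two
    refine ⟨b, a - b, ?_, ?_⟩
    · rw [h1, h3, show μ + 1 + 1 = μ + 2 by ring]; push_cast; ring
    · rw [h2, show μ + 1 + 1 = μ + 2 by ring, h4]; push_cast; ring

/-- In the coordinates `(a, b)` the residue is linear with Fibonacci coefficients, and coordinates
of opposite signs cannot cancel. -/
theorem fib_combination_mul_sub (μ e : ℕ) (a b : ℤ) :
    (a * Nat.fib (μ + 2) + b * Nat.fib (μ + 1)) * (Nat.fib (μ + e + 1) : ℤ)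
      - (a * Nat.fib (μ + 1) + b * Nat.fib μ) * Nat.fib (μ + e + 2)
      = (-1) ^ μ * (b * Nat.fib (e + 1) - a * Nat.fib e) := by
  have h1 := fib_succ_mul_sub μ (e + 1)
  have h2 := fib_succ_mul_sub (μ + 1) e
  rw [show μ + 1 + e = μ + e + 1 by ring, pow_succ] at h2
  rw [show μ + (e + 1) = μ + e + 1 by ring] at h1
  linear_combination b * h1 + a * h2

/-! ### Rotation modulo a Fibonacci number. -/

/-- A step of length at most `N` passes at most one multiple of `N`. -/
theorem parity_ne_of_crossing {N x s T : ℤ} (hN : 0 < N) (h1 : x < T * N) (h2 : T * N ≤ x + s)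
    (hs : s ≤ N) : x / N % 2 ≠ (x + s) / N % 2 := by
  have h3 : x / N = T - 1 := by
    rw [Int.ediv_eq_iff_of_pos hN]
    constructor <;> linarith
  have h4 : (x + s) / N = T := by
    rw [Int.ediv_eq_iff_of_pos hN]
    constructor <;> linarith
  omega

/-- Any `F (m+2)` consecutive points of the rotation by `F n` modulo `F (n+1)` meet every
arc of length `F (n+1-m)`. -/
theorem exists_rotation_mem_arc (n : ℕ) (m e : ℕ) (he : 1 ≤ e) (hn : m + e = n + 1) (z Y : ℤ) :
    ∃ j : ℕ, j < Nat.fib (m + 2) ∧ ∃ T : ℤ, z ≤ Y + j * Nat.fib n - T * Nat.fib (n + 1) ∧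
      Y + j * Nat.fib n - T * Nat.fib (n + 1) < z + Nat.fib e := by
  induction m generalizing e z with
  | zero =>
    have hN : (0 : ℤ) < Nat.fib (n + 1) := by exact_mod_cast Nat.fib_pos.2 (by omega)
    obtain rfl : e = n + 1 := by omega
    refine ⟨0, by simp, (Y - z) / Nat.fib (n + 1), ?_, ?_⟩
    · have := Int.ediv_mul_le (Y - z) hN.ne'
      push_cast; linarith
    · have := Int.lt_ediv_add_one_mul_self (Y - z) hN
      push_cast; linarith
  | succ m ih =>
    obtain ⟨e, rfl⟩ : ∃ e', e = e' + 1 := ⟨e - 1, by omega⟩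
    have hf : Nat.fib (e + 1 + 1) = Nat.fib e + Nat.fib (e + 1) := Nat.fib_add_two
    have hle : Nat.fib e ≤ Nat.fib (e + 1) := Nat.fib_le_fib_succ
    have hg : Nat.fib (m + 1 + 2) = Nat.fib (m + 1) + Nat.fib (m + 2) := Nat.fib_add_two
    have hd := fib_succ_mul_sub m (e + 1)
    obtain rfl : n = m + (e + 1) := by omega
    -- The arc is enlarged by `F e` on the side from which `F (m+1)` more steps, a displacement of
    -- `± F (e+1)`, lead back into it.
    rcases neg_one_pow_eq_or ℤ m with hs | hs <;> rw [hs] at hd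
    · obtain ⟨j, hj, T, h1, h2⟩ := ih (e + 1 + 1) (by omega) (by omega) (z - Nat.fib e)
      rw [hf] at h2; push_cast at h2
      by_cases hz : z ≤ Y + j * Nat.fib (m + (e + 1)) - T * Nat.fib (m + (e + 1) + 1)
      · exact ⟨j, by omega, T, hz, by linarith⟩
      · refine ⟨j + Nat.fib (m + 1), by omega, T + Nat.fib m, ?_, ?_⟩ <;> push_cast <;>
          zify at hle <;> linarith
    · obtain ⟨j, hj, T, h1, h2⟩ := ih (e + 1 + 1) (by omega) (by omega) z
      rw [hf] at h2; push_cast at h2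
      by_cases hz : Y + j * Nat.fib (m + (e + 1)) - T * Nat.fib (m + (e + 1) + 1)
          < z + Nat.fib (e + 1)
      · exact ⟨j, by omega, T, h1, hz⟩
      · refine ⟨j + Nat.fib (m + 1), by omega, T + Nat.fib m, ?_, ?_⟩ <;> push_cast <;>
          zify at hle <;> linarith

/-- If `F m ≤ p < F (m+1)` and `|p F (n-1) - t F n| < F (n-m+2)`, where `m = μ + 2` and
`n = μ + e + 2`, then `p` is a
Fibonacci number, and `t` is the preceding one. -/
theorem eq_fib_of_small (μ e : ℕ) (p t : ℤ) (h1 : (Nat.fib (μ + 2) : ℤ) ≤ p)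
    (h2 : p < Nat.fib (μ + 3))
    (h3 : |p * Nat.fib (μ + e + 1) - t * Nat.fib (μ + e + 2)| < Nat.fib (e + 2)) :
    ∃ m, m ≤ μ + 1 ∧ p = Nat.fib (m + 1) ∧ t = Nat.fib m := by
  obtain ⟨a, b, rfl, rfl⟩ := exists_fib_combination μ p t
  rw [fib_combination_mul_sub, abs_mul, abs_pow, abs_neg, abs_one, one_pow, one_mul, abs_lt] at h3
  have hf : (Nat.fib (μ + 3) : ℤ) = Nat.fib (μ + 1) + Nat.fib (μ + 2) := by
    exact_mod_cast Nat.fib_add_two (n := μ + 1)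
  have hg : (Nat.fib (e + 2) : ℤ) = Nat.fib e + Nat.fib (e + 1) := by
    exact_mod_cast Nat.fib_add_two
  have hle : (Nat.fib e : ℤ) ≤ Nat.fib (e + 1) := by exact_mod_cast Nat.fib_le_fib_succ
  have hle' : (Nat.fib (μ + 1) : ℤ) ≤ Nat.fib (μ + 2) := by
    exact_mod_cast Nat.fib_le_fib_succ
  have he0 : (0 : ℤ) ≤ Nat.fib e := by positivity
  have hp1 : (0 : ℤ) < Nat.fib (μ + 1) := by exact_mod_cast Nat.fib_pos.2 (by omega)
  rw [hf] at h2
  rw [hg] at h3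
  obtain ⟨h3, h4⟩ := h3
  generalize hA : (Nat.fib (μ + 2) : ℤ) = A at *
  generalize hB : (Nat.fib (μ + 1) : ℤ) = B at *
  generalize (Nat.fib (e + 1) : ℤ) = D at *
  generalize (Nat.fib e : ℤ) = E at *
  -- If `a` and `b` have opposite signs, `|bD - aE|` is at least `D + E`; only `(1, 0)` and `(0, 1)`
  -- survive.
  rcases lt_trichotomy b 0 with hb | rfl | hb
  · exfalso
    have ha : 2 ≤ a := by
      by_contra! ha
      nlinarith [mul_nonneg (show 0 ≤ 1 - a by omega) (show 0 ≤ A by linarith)]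
    nlinarith [mul_nonneg (show 0 ≤ a - 2 by omega) he0,
      mul_nonneg (show 0 ≤ -1 - b by omega) (show 0 ≤ D by linarith)]
  · have ha : a = 1 := by
      have h5 : a < 2 := by by_contra! ha; nlinarith
      have h6 : 0 < a := by by_contra! ha; nlinarith
      omega
    subst ha
    exact ⟨μ + 1, le_rfl, by rw [hA]; ring, by rw [hB]; ring⟩
  · have ha : a ≤ 0 := by by_contra! ha; nlinarith
    have ha' : 0 ≤ a := by
      by_contra! ha'
      nlinarith [mul_nonneg (show 0 ≤ -1 - a by omega) he0,
        mul_nonneg (show 0 ≤ b - 1 by omega) (show 0 ≤ D by linarith)]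
    obtain rfl : a = 0 := le_antisymm ha ha'
    have hb1 : b = 1 := by
      by_contra hb1
      nlinarith [mul_nonneg (show 0 ≤ b - 2 by omega) (show 0 ≤ D by linarith)]
    subst hb1
    exact ⟨μ, by omega, by rw [hB]; ring, by ring⟩

/-! ### Excluding the pattern from the coding. -/

/-- The arithmetic heart: the coding of the rotation by `F n / (2 F (n+1))` with respect to the two
half-circles has no factor `x x x^R` when `n ≡ 1 (mod 3)`. -/
theorem no_XXXR_rotation (n : ℕ) (hn : n % 3 = 1) (Y : ℤ) (p : ℕ) (hp : 0 < p)
    (hpal : ∀ j : ℕ, j < p → (Y + j * Nat.fib n) / Nat.fib (n + 1) % 2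
      = (Y - (j + 1) * Nat.fib n) / Nat.fib (n + 1) % 2)
    (hsq : ∀ j : ℕ, j < p → (Y - 2 * p * Nat.fib n + j * Nat.fib n) / Nat.fib (n + 1) % 2
      = (Y - p * Nat.fib n + j * Nat.fib n) / Nat.fib (n + 1) % 2) : False := by
  obtain ⟨M, hM⟩ : ∃ M : ℤ, M = Nat.fib n := ⟨_, rfl⟩
  obtain ⟨N, hN⟩ : ∃ N : ℤ, N = Nat.fib (n + 1) := ⟨_, rfl⟩
  have hN0 : 0 < N := by rw [hN]; exact_mod_cast Nat.fib_pos.2 (by omega)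
  have hM2 : M % 2 = 1 := by
    have := fib_mod_two n
    rw [if_neg (by omega)] at this
    omega
  have hN2 : N % 2 = 1 := by
    have := fib_mod_two (n + 1)
    rw [if_neg (by omega)] at this
    omega
  simp only [← hM, ← hN] at hpal hsq
  -- the palindrome as invariance of the coding under a translation by an odd number
  obtain ⟨s, t', hs, hs1, hs2⟩ : ∃ s t' : ℤ, N - 1 + M - 2 * Y = s + 2 * t' * N ∧ -N ≤ s ∧
      s < N := by
    refine ⟨(N - 1 + M - 2 * Y + N) % (2 * N) - N, (N - 1 + M - 2 * Y + N) / (2 * N), ?_, ?_, ?_⟩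
    · have := Int.emod_add_mul_ediv (N - 1 + M - 2 * Y + N) (2 * N)
      linarith
    · have := Int.emod_nonneg (N - 1 + M - 2 * Y + N) (show 2 * N ≠ 0 by omega)
      linarith
    · have := Int.emod_lt_of_pos (N - 1 + M - 2 * Y + N) (show 0 < 2 * N by omega)
      linarith
  have hsodd : s % 2 = 1 := by
    have h : (2 * t' * N) % 2 = 0 := by rw [mul_assoc]; omega
    omega
  -- Both `w ↦ -1 - w` and the translation by an odd multiple of `N` reverse letters, so their
  -- composite preserves them.
  have hrefl : ∀ v w : ℤ, v + w = 2 * Y - M → v / N % 2 = w / N % 2 →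
      v / N % 2 = (v + s) / N % 2 := by
    intro v w hvw h
    have h1 : v + s = (-1 - w) + (1 - 2 * t') * N := by linear_combination -hs + hvw
    have h2 : (-1 - w) / N = -1 - w / N := by
      rw [Int.ediv_eq_iff_of_pos hN0]
      have := Int.ediv_mul_le w hN0.ne'
      have := Int.lt_ediv_add_one_mul_self w hN0
      constructor <;> linarith
    rw [h1, Int.add_mul_ediv_right _ _ hN0.ne', h2]
    omega
  have hpal' : ∀ j : ℤ, -p ≤ j → j < p → (Y + j * M) / N % 2 = (Y + j * M + s) / N % 2 := by
    intro j hj1 hj2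
    rcases le_or_gt 0 j with h0 | h0
    · lift j to ℕ using h0
      exact hrefl _ _ (by ring) (hpal j (by omega))
    · obtain ⟨i, hi⟩ := Int.eq_ofNat_of_zero_le (show 0 ≤ -1 - j by omega)
      have h := hpal i (by omega)
      rw [show Y - ((i : ℤ) + 1) * M = Y + j * M by rw [← hi]; ring] at h
      exact hrefl _ _ (by rw [← hi]; ring) h.symm
  have hcross : ∀ (x q T : ℤ), |q| ≤ N → x / N % 2 = (x + q) / N % 2 →
      ¬ (x < T * N ∧ T * N ≤ x + q) ∧ ¬ (x + q < T * N ∧ T * N ≤ x) := by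
    intro x q T hq h
    rw [abs_le] at hq
    constructor
    · rintro ⟨h1, h2⟩
      exact parity_ne_of_crossing hN0 h1 h2 hq.2 h
    · rintro ⟨h1, h2⟩
      refine parity_ne_of_crossing (s := -q) hN0 h1 (by linarith) (by linarith) ?_
      rw [add_neg_cancel_right]; exact h.symm
  have hsN : |s| ≤ N := abs_le.2 ⟨hs1, hs2.le⟩
  -- an arc of length `|q|` is met by enough points
  have hmeet : ∀ (m e : ℕ) (q X : ℤ), 1 ≤ e → m + e = n + 1 → Nat.fib (m + 2) ≤ p → |q| ≤ N →
      (∀ j : ℕ, j < p → (X + j * M) / N % 2 = (X + j * M + q) / N % 2) → |q| < Nat.fib e := by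
    intro m e q X he hme hm hq h
    by_contra! hqe
    have he1 : (0 : ℤ) < Nat.fib e := by exact_mod_cast Nat.fib_pos.2 (by omega)
    rcases le_or_gt 0 q with h0 | h0
    · rw [abs_of_nonneg h0] at hqe
      obtain ⟨j, hj, T, h1, h2⟩ := exists_rotation_mem_arc n m e he hme (-Nat.fib e) X
      rw [← hM, ← hN] at h1 h2
      exact (hcross _ q T hq (h j (by omega))).1 ⟨by linarith, by linarith⟩
    · rw [abs_of_neg h0] at hqe
      obtain ⟨j, hj, T, h1, h2⟩ := exists_rotation_mem_arc n m e he hme 0 X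
      rw [← hM, ← hN] at h1 h2
      exact (hcross _ q T hq (h j (by omega))).2 ⟨by linarith, by linarith⟩
  -- Otherwise arcs of length `F 2 = 1` are met and `s = 0`, although `s` is odd.
  have hpN : p < Nat.fib (n + 1) := by
    by_contra! hpN
    obtain ⟨n', rfl⟩ : ∃ n', n = n' + 1 := ⟨n - 1, by omega⟩
    have := hmeet n' 2 s Y (by omega) (by omega) hpN hsN
      (fun j hj => hpal' j (by omega) (by omega))
    rw [Nat.fib_two] at this
    have := abs_lt.1 this
    omega
  -- the period of the square
  obtain ⟨t, q, hq, ht, hqN⟩ : ∃ t q : ℤ, p * M = t * N + q ∧ t % 2 = 0 ∧ |q| ≤ N := by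
    refine ⟨2 * ((p * M + N) / (2 * N)), (p * M + N) % (2 * N) - N, ?_, by omega, ?_⟩
    · have := Int.emod_add_mul_ediv (p * M + N) (2 * N)
      linarith
    · have := Int.emod_nonneg (p * M + N) (show 2 * N ≠ 0 by omega)
      have := Int.emod_lt_of_pos (p * M + N) (show 0 < 2 * N by omega)
      rw [abs_le]
      constructor <;> linarith
  have hsq' : ∀ j : ℕ, j < p → (Y - 2 * p * M + j * M) / N % 2
      = (Y - 2 * p * M + j * M + q) / N % 2 := by
    intro j hj
    rw [hsq j hj, show Y - p * M + j * M = Y - 2 * p * M + j * M + q + t * N by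
      linear_combination hq, Int.add_mul_ediv_right _ _ hN0.ne']
    omega
  obtain ⟨m, hmn, hpm, htm⟩ : ∃ m, m + 1 ≤ n ∧ (p : ℤ) = Nat.fib (m + 1) ∧ t = Nat.fib m := by
    obtain ⟨μ, hμ1, hμ2⟩ : ∃ μ, Nat.fib (μ + 2) ≤ p ∧ p < Nat.fib (μ + 3) := by
      have hex : ∃ μ, p < Nat.fib (μ + 3) :=
        ⟨n, hpN.trans_le (Nat.fib_mono (by omega))⟩
      refine ⟨Nat.find hex, ?_, Nat.find_spec hex⟩
      rcases Nat.eq_zero_or_pos (Nat.find hex) with h | h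
      · rw [h]; exact hp
      · obtain ⟨i, hi⟩ : ∃ i, Nat.find hex = i + 1 := ⟨Nat.find hex - 1, by omega⟩
        have := Nat.find_min hex (m := i) (by omega)
        rw [hi]
        simpa using this
    have hμn : μ + 2 < n + 1 := by
      by_contra! h
      have := Nat.fib_mono h
      omega
    obtain ⟨e, rfl⟩ : ∃ e, n = μ + e + 1 := ⟨n - μ - 1, by omega⟩
    have h := hmeet μ (e + 2) q _ (by omega) (by omega) hμ1 hqN hsq'
    obtain ⟨m, hm, h1, h2⟩ := eq_fib_of_small μ e p t (by exact_mod_cast hμ1)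
      (by exact_mod_cast hμ2) (by rw [← hM, show μ + e + 2 = μ + e + 1 + 1 by ring, ← hN, hq]
                                  simpa using h)
    exact ⟨m, by omega, h1, h2⟩
  -- `t` is even because `q` represents `pM` modulo `2N`, not merely modulo `N`.
  have hm3 : m % 3 = 0 := by
    by_contra h
    have := fib_mod_two m
    rw [if_neg h] at this
    omega
  -- explicit positions
  obtain ⟨e, rfl⟩ : ∃ e, n = m + e + 1 := ⟨n - m - 1, by omega⟩
  have hd := fib_combination_mul_sub m e
  rw [← hM, show m + e + 2 = m + e + 1 + 1 by ring, ← hN] at hd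
  have hd1 := hd 1 0
  have hd0 := hd 0 1
  have hF1 : (Nat.fib (m + 1) : ℤ) % 2 = 1 := by
    have := fib_mod_two (m + 1)
    rw [if_neg (by omega)] at this
    omega
  have hF2 : (Nat.fib (m + 2) : ℤ) % 2 = 1 := by
    have := fib_mod_two (m + 2)
    rw [if_neg (by omega)] at this
    omega
  have hE2 : (Nat.fib e : ℤ) % 2 = 0 := by
    have := fib_mod_two e
    rw [if_pos (by omega)] at this
    omega
  have hF : (Nat.fib (m + 2) : ℤ) = Nat.fib m + Nat.fib (m + 1) := by
    exact_mod_cast Nat.fib_add_two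
  have hFle : (Nat.fib m : ℤ) ≤ Nat.fib (m + 1) := by exact_mod_cast Nat.fib_le_fib_succ
  have hDle : (Nat.fib e : ℤ) ≤ Nat.fib (e + 1) := by exact_mod_cast Nat.fib_le_fib_succ
  have hE0 : (0 : ℤ) ≤ Nat.fib e := by positivity
  rw [← hpm] at hd1 hd0 hF1 hF hFle
  rw [← htm] at hd0 hF hFle
  generalize (Nat.fib (m + 2) : ℤ) = G at *
  generalize (Nat.fib (e + 1) : ℤ) = D at *
  generalize (Nat.fib e : ℤ) = E at *
  obtain ⟨σ, hσ⟩ : ∃ σ : ℤ, σ = (-1) ^ m := ⟨_, rfl⟩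
  have hσ' : σ = 1 ∨ σ = -1 := by rw [hσ]; exact neg_one_pow_eq_or ℤ m
  rw [← hσ] at hd1 hd0
  have hGM : G * M = p * N - σ * E := by linear_combination hd1
  have hqD : q = σ * D := by linear_combination hd0 - hq
  -- The points of indices `g` and `-g-1` are mirror images about the centre of the palindrome and
  -- differ by `GM = pN - σE`. The third point lies `p` steps before the second.
  obtain ⟨g, hg⟩ : ∃ g, G = 2 * g + 1 := ⟨G / 2, by omega⟩
  obtain ⟨c, hc⟩ : ∃ c, (p : ℤ) = 2 * c + 1 := ⟨p / 2, by omega⟩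
  obtain ⟨E', hE'⟩ : ∃ E', E = 2 * E' := ⟨E / 2, by omega⟩
  obtain ⟨s', hs'⟩ : ∃ s', s = 2 * s' + 1 := ⟨s / 2, by omega⟩
  have hx1 : Y + g * M = (c + 1 - t') * N + (-σ * E' - 1 - s') := by
    have : 2 * (Y + g * M) = 2 * ((c + 1 - t') * N + (-σ * E' - 1 - s')) := by
      linear_combination hGM - hs - M * hg + N * hc - σ * hE' - hs'
    omega
  have hx2 : Y + (-g - 1) * M = (-c - t') * N + (σ * E' - 1 - s') := by
    have : 2 * (Y + (-g - 1) * M) = 2 * ((-c - t') * N + (σ * E' - 1 - s')) := by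
      linear_combination -hGM - hs + M * hg - N * hc + σ * hE' - hs'
    omega
  have hx3 : Y + (-p - g - 1) * M = (-t - c - t') * N + (σ * E' - 1 - s' - q) := by
    linear_combination hx2 - hq
  have hb1 := hcross _ s (c + 1 - t') hsN (hpal' g (by omega) (by omega))
  have hb2 := hcross _ s (-c - t') hsN (hpal' (-g - 1) (by omega) (by omega))
  have hj : (0 : ℤ) ≤ p - g - 1 := by omega
  obtain ⟨j, hj'⟩ := Int.eq_ofNat_of_zero_le hj
  have hb3 := hcross _ q (-t - c - t') hqN (hsq' j (by omega))
  rw [show Y - 2 * p * M + (j : ℤ) * M = Y + (-p - g - 1) * M by rw [← hj']; ring, hx3] at hb3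
  rw [hx1] at hb1
  rw [hx2] at hb2
  generalize (c + 1 - t') * N = Z1 at *
  generalize (-c - t') * N = Z2 at *
  generalize (-t - c - t') * N = Z3 at *
  -- That `s` moves neither of the first two points across a multiple of `N` gives `|s| < E ≤ D`;
  -- then `q = σD` carries the third one across.
  rcases hσ' with rfl | rfl <;> omega

/-! ### The Rote-Fibonacci word as a rotation coding. -/

theorem roteFibonacci_fib_add (m i : ℕ) (hi : i < Nat.fib (m + 2)) :
    roteFibonacci (Nat.fib (m + 3) + i)
      = if (m + 2) % 3 = 0 then roteFibonacci i else !roteFibonacci i := by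
  have hl1 : (finiteRoteFibonacci (m + 1)).length = Nat.fib (m + 3) :=
    length_finiteRoteFibonacci (m + 1)
  have hl0 := length_finiteRoteFibonacci m
  have hl := length_finiteRoteFibonacci (m + 2)
  have hf : Nat.fib (m + 2 + 2) = Nat.fib (m + 2) + Nat.fib (m + 3) := Nat.fib_add_two
  have hlt : Nat.fib (m + 3) + i < (finiteRoteFibonacci (m + 2)).length := by omega
  have hlt0 : i < (finiteRoteFibonacci m).length := by omega
  rw [← getElem_finiteRoteFibonacci hlt, ← getElem_finiteRoteFibonacci hlt0]
  simp only [finiteRoteFibonacci]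
  split_ifs
  · rw [List.getElem_append_right (by omega)]
    congr 1
    omega
  · rw [List.getElem_append_right (by omega), List.getElem_map]
    congr 2
    omega

/-- A translation by `± F e` of the points `h F (n-1) - ε` with `2 ≤ h ≤ F (n-e-1) + 1`, where
`n = μ + e + 2`, does not move them across a multiple of `F n`. -/
theorem rotation_ediv_eq (μ e : ℕ) (hμ : 1 ≤ μ) (he : 1 ≤ e) (ε h : ℤ)
    (hε : ε = if (μ + e) % 2 = 0 then 1 else 0) (h2 : 2 ≤ h) (hle : h ≤ Nat.fib (μ + 1) + 1) :
    (h * Nat.fib (μ + e + 1) - ε + (-1) ^ (μ + 1) * Nat.fib e) / Nat.fib (μ + e + 2)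
      = (h * Nat.fib (μ + e + 1) - ε) / (Nat.fib (μ + e + 2) : ℤ) := by
  have hN0 : (0 : ℤ) < Nat.fib (μ + e + 2) := by exact_mod_cast Nat.fib_pos.2 (by omega)
  have hE : (0 : ℤ) < Nat.fib e := by exact_mod_cast Nat.fib_pos.2 (by omega)
  have hDE : (Nat.fib e : ℤ) ≤ Nat.fib (e + 1) := by exact_mod_cast Nat.fib_le_fib_succ
  have hB : (0 : ℤ) < Nat.fib (μ + 1) := by exact_mod_cast Nat.fib_pos.2 (by omega)
  have hAB : (Nat.fib (μ + 1) : ℤ) ≤ Nat.fib (μ + 2) := by exact_mod_cast Nat.fib_le_fib_succ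
  have hA : (2 : ℤ) ≤ Nat.fib (μ + 2) := by
    exact_mod_cast Nat.fib_mono (show 3 ≤ μ + 2 by omega)
  have hEN : (Nat.fib e : ℤ) ≤ Nat.fib (μ + e + 2) := by
    exact_mod_cast Nat.fib_mono (by omega)
  -- A crossing puts `h F (n-1)` within `F e` of a multiple of `F n`. This leaves only the boundary
  -- case `e = 1` with residue `± 1`, which the choice of `ε` by parity rules out.
  have key : ∀ t E₀ : ℤ, h * Nat.fib (μ + e + 1) - t * Nat.fib (μ + e + 2) = (-1) ^ μ * E₀ →
      0 ≤ E₀ → E₀ ≤ Nat.fib e → E₀ = Nat.fib e ∧ E₀ = 1 ∧ e = 1 := by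
    intro t E₀ ht h0 h1
    obtain ⟨a, b, rfl, rfl⟩ := exists_fib_combination μ h t
    rw [fib_combination_mul_sub] at ht
    have hE₀ := mul_left_cancel₀ (pow_ne_zero μ (by norm_num : (-1 : ℤ) ≠ 0)) ht
    have hab : a = 0 ∧ b = 1 ∧ (Nat.fib e : ℤ) = Nat.fib (e + 1) := by
      clear ht
      subst hE₀
      generalize (Nat.fib (μ + 2) : ℤ) = A at *
      generalize (Nat.fib (μ + 1) : ℤ) = B at *
      generalize (Nat.fib (e + 1) : ℤ) = D at *
      generalize (Nat.fib e : ℤ) = E at *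
      have ha : a ≤ 0 := by
        by_contra! ha
        rcases le_or_gt b 0 with hb | hb
        · nlinarith
        · nlinarith
      have ha' : 0 ≤ a := by
        by_contra! ha'
        have hb : 1 ≤ b := by by_contra! hb; nlinarith
        nlinarith
      obtain rfl : a = 0 := le_antisymm ha ha'
      have hb : 1 ≤ b := by by_contra! hb; nlinarith
      have hb' : b ≤ 1 := by by_contra! hb'; nlinarith
      obtain rfl : b = 1 := le_antisymm hb' hb
      exact ⟨rfl, rfl, by linarith⟩
    obtain ⟨rfl, rfl, hab⟩ := hab
    have he1 : e = 1 := by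
      by_contra he1
      have := Nat.fib_lt_fib_succ (show 2 ≤ e by omega)
      omega
    subst he1
    simp at hE₀
    simp [← hE₀]
  have hε' : ε = 0 ∨ ε = 1 := by split_ifs at hε <;> simp [hε]
  obtain ⟨X, hX⟩ : ∃ X : ℤ, X = h * Nat.fib (μ + e + 1) - ε := ⟨_, rfl⟩
  have hXm : ∀ t : ℤ, h * Nat.fib (μ + e + 1) - t * Nat.fib (μ + e + 2)
      = X + ε - t * Nat.fib (μ + e + 2) := fun t => by rw [hX]; ring
  rw [← hX]
  rcases Nat.even_or_odd μ with hpar | hpar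
  · rw [pow_succ, hpar.neg_one_pow] at *
    have h3 := Int.ediv_mul_le (X) hN0.ne'
    have h4 := Int.lt_ediv_add_one_mul_self (X) hN0
    rw [Int.ediv_eq_iff_of_pos hN0]
    refine ⟨?_, by linarith⟩
    by_contra! hc
    have := key (X / Nat.fib (μ + e + 2)) (X + ε - X / Nat.fib (μ + e + 2) * Nat.fib (μ + e + 2))
      (by rw [hXm, one_mul]) (by omega) (by omega)
    have := Nat.even_iff.1 hpar
    rw [if_neg (by omega)] at hε
    omega
  · rw [pow_succ, hpar.neg_one_pow] at *
    have h3 := Int.ediv_mul_le (X) hN0.ne'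
    have h4 := Int.lt_ediv_add_one_mul_self (X) hN0
    rw [Int.ediv_eq_iff_of_pos hN0]
    refine ⟨by linarith, ?_⟩
    by_contra! hc
    rw [add_mul, one_mul] at h4
    have hk := key (X / Nat.fib (μ + e + 2) + 1)
      (-(X + ε - (X / Nat.fib (μ + e + 2) + 1) * Nat.fib (μ + e + 2)))
      (by rw [hXm]; ring) (by rw [add_mul, one_mul]; omega) (by rw [add_mul, one_mul]; omega)
    have := Nat.odd_iff.1 hpar
    rw [if_pos (by omega)] at hε
    rw [add_mul, one_mul] at hk
    omega

/-- The prefix of length `F (n+1)` of the Rote-Fibonacci word codes a rotation. -/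
theorem roteFibonacci_eq_rotation (n : ℕ) (hn : 3 ≤ n) (ε : ℤ)
    (hε : ε = if n % 2 = 1 then 1 else 0) (m : ℕ) (hm : m + 1 ≤ n) (i : ℕ)
    (hi : i < Nat.fib (m + 2)) :
    roteFibonacci i
      = decide (((i + 2) * Nat.fib n - ε) / (Nat.fib (n + 1) : ℤ) % 2 = 0) := by
  induction m using Nat.strong_induction_on generalizing i with
  | _ m ih =>
    have hN0 : (0 : ℤ) < Nat.fib (n + 1) := by exact_mod_cast Nat.fib_pos.2 (by omega)
    have hbase : ∀ j : ℤ, (j = 2 ∨ j = 3) → (j * Nat.fib n - ε) / (Nat.fib (n + 1) : ℤ) = 1 := by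
      intro j hj
      obtain ⟨l, rfl⟩ : ∃ l, n = l + 3 := ⟨n - 3, by omega⟩
      have h1 : Nat.fib (l + 3 + 1) = Nat.fib (l + 2) + Nat.fib (l + 3) := Nat.fib_add_two
      have h2 : Nat.fib (l + 3) = Nat.fib (l + 1) + Nat.fib (l + 2) := Nat.fib_add_two
      have h3 : Nat.fib (l + 2) = Nat.fib l + Nat.fib (l + 1) := Nat.fib_add_two
      have h4 : 0 < Nat.fib (l + 1) := Nat.fib_pos.2 (by omega)
      have h5 : 0 < Nat.fib l ∨ l = 0 := by
        rcases Nat.eq_zero_or_pos l with h | h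
        · exact Or.inr h
        · exact Or.inl (Nat.fib_pos.2 h)
      have hε' : ε = 0 ∨ ε = 1 := by split_ifs at hε <;> simp [hε]
      rw [Int.ediv_eq_iff_of_pos hN0]
      rcases hj with rfl | rfl <;> constructor <;> omega
    match m, ih with
    | 0, _ =>
      obtain rfl : i = 0 := by simpa using hi
      rw [Nat.cast_zero, zero_add, hbase 2 (by simp)]
      rfl
    | 1, _ =>
      have hi' : i < 2 := hi
      interval_cases i
      · rw [Nat.cast_zero, zero_add, hbase 2 (by simp)]
        rfl
      · rw [Nat.cast_one, show (1 : ℤ) + 2 = 3 by norm_num, hbase 3 (by simp)]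
        rfl
    | m + 2, ih =>
      by_cases hlt : i < Nat.fib (m + 1 + 2)
      · exact ih (m + 1) (by omega) (by omega) i hlt
      · have hf : Nat.fib (m + 2 + 2) = Nat.fib (m + 2) + Nat.fib (m + 3) := Nat.fib_add_two
        obtain ⟨i, rfl⟩ : ∃ i', i = Nat.fib (m + 3) + i' :=
          ⟨i - Nat.fib (m + 3), by rw [show m + 3 = m + 1 + 2 by ring]; omega⟩
        have hi' : i < Nat.fib (m + 2) := by omega
        rw [roteFibonacci_fib_add m i hi', ih m (by omega) (by omega) i hi']
        obtain ⟨e, rfl⟩ : ∃ e, n = m + 1 + (e + 1) + 1 := ⟨n - m - 3, by omega⟩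
        have hd := fib_succ_mul_sub (m + 2) (e + 1)
        have hr := rotation_ediv_eq (m + 1) (e + 1) (by omega) (by omega) ε (i + 2)
          (by rw [hε]; congr 1; simp; omega) (by omega)
          (by rw [show m + 1 + 1 = m + 2 by ring]; omega)
        have hq : (((Nat.fib (m + 3) + i : ℕ) + 2 : ℤ) * Nat.fib (m + 1 + (e + 1) + 1) - ε)
            / Nat.fib (m + 1 + (e + 1) + 1 + 1)
            = ((i + 2 : ℤ) * Nat.fib (m + 1 + (e + 1) + 1) - ε)
              / Nat.fib (m + 1 + (e + 1) + 1 + 1) + Nat.fib (m + 2) := by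
          rw [show m + 1 + (e + 1) + 1 + 1 = m + 1 + (e + 1) + 2 by ring] at *
          rw [← hr, ← Int.add_mul_ediv_right _ _ hN0.ne']
          congr 1
          rw [show m + 2 + (e + 1) + 1 = m + 1 + (e + 1) + 2 by ring,
            show m + 2 + (e + 1) = m + 1 + (e + 1) + 1 by ring] at hd
          push_cast
          rw [show m + 3 = m + 2 + 1 by ring, show m + 1 + 1 = m + 2 by ring]
          linear_combination hd
        rw [hq]
        -- The quotient grows by `F (m+2)`, which is even exactly when the recursion copies instead
        -- of complementing.
        have hmod := fib_mod_two (m + 2)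
        by_cases h3 : (m + 2) % 3 = 0
        · rw [if_pos h3] at hmod ⊢
          rw [decide_eq_decide]
          omega
        · rw [if_neg h3] at hmod ⊢
          rw [← decide_not, decide_eq_decide]
          omega

/-- The prefix of length `2 F (3k+2)` is a word followed by its complement. -/
theorem roteFibonacci_add_fib (k i : ℕ) (hk : 1 ≤ k) (hi : i < Nat.fib (3 * k + 2)) :
    roteFibonacci (Nat.fib (3 * k + 2) + i) = !roteFibonacci i := by
  obtain ⟨k, rfl⟩ : ∃ k', k = k' + 1 := ⟨k - 1, by omega⟩
  rw [show 3 * (k + 1) + 2 = 3 * k + 5 by ring] at *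
  have h5 : Nat.fib (3 * k + 5) = Nat.fib (3 * k + 3) + Nat.fib (3 * k + 4) := Nat.fib_add_two
  have h6 : Nat.fib (3 * k + 6) = Nat.fib (3 * k + 4) + Nat.fib (3 * k + 5) := Nat.fib_add_two
  by_cases hlt : i < Nat.fib (3 * k + 4)
  · have := roteFibonacci_fib_add (3 * k + 2) i hlt
    rwa [if_neg (by omega)] at this
  -- Here the letter at `F (3k+4) + i` copies that at `i`, while the one at `F (3k+6) + i`
  -- complements it.
  · obtain ⟨i, rfl⟩ : ∃ i', i = Nat.fib (3 * k + 4) + i' := ⟨i - Nat.fib (3 * k + 4), by omega⟩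
    have hi' : i < Nat.fib (3 * k + 3) := by omega
    have h1 := roteFibonacci_fib_add (3 * k + 1) i hi'
    have h2 := roteFibonacci_fib_add (3 * k + 3) i
      (hi'.trans_le (Nat.fib_mono (by omega)))
    rw [if_pos (by omega)] at h1
    rw [if_neg (by omega)] at h2
    rw [h1, ← h2]
    congr 1
    rw [show 3 * k + 3 + 3 = 3 * k + 6 by ring]
    omega

theorem omegaPower_eq_rotation (k : ℕ) (hk : 1 ≤ k) (z : List Bool)
    (hz : z = wordFactor roteFibonacci 0 (2 * Nat.fib (3 * k + 2))) (hne : z ≠ []) :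
    ∃ c : ℤ, ∀ i : ℕ, omegaPower z hne i
      = decide ((i * Nat.fib (3 * k + 1) + c) / (Nat.fib (3 * k + 2) : ℤ) % 2 = 0) := by
  obtain ⟨ε, hε⟩ : ∃ ε : ℤ, ε = if (3 * k + 1) % 2 = 1 then 1 else 0 := ⟨_, rfl⟩
  have hlow : ∀ i, i < Nat.fib (3 * k + 2) → roteFibonacci i
      = decide (((i + 2) * Nat.fib (3 * k + 1) - ε) / (Nat.fib (3 * k + 2) : ℤ) % 2 = 0) :=
    fun i hi => roteFibonacci_eq_rotation (3 * k + 1) (by omega) ε hε (3 * k) (by omega) i hi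
  have hM := fib_mod_two (3 * k + 1)
  rw [if_neg (by omega)] at hM
  have hN0 : (0 : ℤ) < Nat.fib (3 * k + 2) := by exact_mod_cast Nat.fib_pos.2 (by omega)
  refine ⟨2 * Nat.fib (3 * k + 1) - ε, fun i => ?_⟩
  have hl : z.length = 2 * Nat.fib (3 * k + 2) := by simp [hz, wordFactor]
  have hget : omegaPower z hne i = roteFibonacci (i % (2 * Nat.fib (3 * k + 2))) := by
    subst hz
    simp [omegaPower, wordFactor]
  rw [hget]
  have hdiv := Nat.mod_add_div i (2 * Nat.fib (3 * k + 2))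
  have hlt := Nat.mod_lt i (show 0 < 2 * Nat.fib (3 * k + 2) by omega)
  generalize i % (2 * Nat.fib (3 * k + 2)) = r at *
  generalize i / (2 * Nat.fib (3 * k + 2)) = d at *
  -- Each block of `F (3k+2)` indices adds the odd number `F (3k+1)` to the quotient, so consecutive
  -- blocks are complementary.
  have hsplit : ∀ j l : ℕ, i = j + l * Nat.fib (3 * k + 2) →
      ((i : ℤ) * Nat.fib (3 * k + 1) + (2 * Nat.fib (3 * k + 1) - ε)) / Nat.fib (3 * k + 2)
      = ((j + 2) * Nat.fib (3 * k + 1) - ε) / Nat.fib (3 * k + 2)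
        + l * Nat.fib (3 * k + 1) := by
    intro j l hjl
    rw [← Int.add_mul_ediv_right _ _ hN0.ne', hjl]
    congr 1
    push_cast
    ring
  by_cases hr : r < Nat.fib (3 * k + 2)
  · rw [hlow r hr, hsplit r (2 * d) (by rw [← hdiv]; ring)]
    congr 1
    have : ((2 * d : ℕ) : ℤ) * Nat.fib (3 * k + 1) = 2 * (d * Nat.fib (3 * k + 1)) := by
      push_cast; ring
    rw [this]
    simp
  · obtain ⟨j, rfl⟩ : ∃ j, r = Nat.fib (3 * k + 2) + j := ⟨r - Nat.fib (3 * k + 2), by omega⟩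
    have hj : j < Nat.fib (3 * k + 2) := by omega
    rw [roteFibonacci_add_fib k j hk hj, hlow j hj,
      hsplit j (2 * d + 1) (by rw [← hdiv]; ring), ← decide_not]
    congr 1
    have : ((2 * d + 1 : ℕ) : ℤ) * Nat.fib (3 * k + 1)
        = 2 * (d * Nat.fib (3 * k + 1)) + Nat.fib (3 * k + 1) := by
      push_cast; ring
    rw [this]
    simp only [eq_iff_iff]
    omega

/-! ### From the pattern to letters, and conclusion. -/

theorem ContainsXXXR.exists_letters {α : Type*} {u : ℕ → α} (h : ContainsXXXR u) :
    ∃ i p : ℕ, 0 < p ∧ ∀ j < p, u (i + j) = u (i + p + j) ∧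
      u (i + 2 * p + j) = u (i + 2 * p - 1 - j) := by
  obtain ⟨x, hx, i, h⟩ := h
  have hl : (x ++ x ++ x.reverse).length = 3 * x.length := by simp; ring
  have hu : ∀ j (hj : j < (x ++ x ++ x.reverse).length),
      u (i + j) = (x ++ x ++ x.reverse)[j] := by
    intro j hj
    rw [← List.getElem_of_eq h (by simpa [wordFactor] using hj)]
    simp [wordFactor]
  have h1 : ∀ j (hj : j < x.length), u (i + j) = x[j] := fun j hj => by
    rw [hu j (by omega), List.getElem_append_left (by simp; omega),
      List.getElem_append_left hj]
  have h2 : ∀ j (hj : j < x.length), u (i + x.length + j) = x[j] := fun j hj => by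
    rw [add_assoc, hu (x.length + j) (by omega), List.getElem_append_left (by simp; omega),
      List.getElem_append_right (by omega)]
    simp
  have h3 : ∀ j (hj : j < x.length),
      u (i + 2 * x.length + j) = x[x.length - 1 - j] := fun j hj => by
    rw [add_assoc, hu (2 * x.length + j) (by omega),
      List.getElem_append_right (by simp; omega), List.getElem_reverse]
    congr 1
    simp
    omega
  refine ⟨i, x.length, List.length_pos_iff.2 hx, fun j hj => ⟨?_, ?_⟩⟩
  · rw [h1 j hj, h2 j hj]
  · rw [h3 j hj, ← h2 _ (by omega)]
    congr 1
    omega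

theorem mainTheorem8 (k : ℕ) (hk : 1 ≤ k) (n : ℕ) (hn : n = 2 * Nat.fib (3 * k + 2))
    (z : List Bool) (hz : z = wordFactor roteFibonacci 0 n) :
    ∃ hne : z ≠ [], ¬ ContainsXXXR (omegaPower z hne) := by
  subst hn
  have hN0 : 0 < Nat.fib (3 * k + 2) := Nat.fib_pos.2 (by omega)
  have hne : z ≠ [] := by
    rw [← List.length_pos_iff, hz]
    simp [wordFactor, hN0]
  refine ⟨hne, fun h => ?_⟩
  obtain ⟨c, hc⟩ := omegaPower_eq_rotation k hk z hz hne
  obtain ⟨i, p, hp, h⟩ := h.exists_letters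
  have hmod : ∀ a b : ℤ, decide (a % 2 = 0) = decide (b % 2 = 0) → a % 2 = b % 2 := by
    intro a b hab
    rw [decide_eq_decide] at hab
    omega
  -- The base point is that of the first letter of `x^R`.
  refine no_XXXR_rotation (3 * k + 1) (by omega) ((i + 2 * p : ℤ) * Nat.fib (3 * k + 1) + c) p hp
    (fun j hj => ?_) (fun j hj => ?_)
  · have h1 := (h j hj).2
    rw [hc, hc] at h1
    convert hmod _ _ h1 using 3
    · push_cast; ring
    · rw [show i + 2 * p - 1 - j = i + 2 * p - (1 + j) by omega, Nat.cast_sub (by omega)]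
      push_cast; ring
  · have h1 := (h j hj).1
    rw [hc, hc] at h1
    convert hmod _ _ h1 using 3 <;> push_cast <;> ring
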